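/- Let $(X,\mathcal A,\mu)$ be a non-atomic probability space and let $k\ge 2$ be an integer. Let $\mathcal T\subseteq\mathcal A$ be a $k$-homogeneous tree on $X$: $X\in\mathcal T$; to every $I\in\mathcal T$ there corresponds a set $C(I)\subseteq\mathcal T$ of exactly $k$ pairwise disjoint subsets of $I$ with $I=\bigcup C(I)$ and $\mu(J)=\frac1k\mu(I)$ for every $J\in C(I)$; and every element of $\mathcal T$ is obtained from $X$ by finitely many passages from a set $I$ to an element of $C(I)$. Assume that $\mathcal T$ generates $\mathcal A$ up to null sets, i.e. every $A\in\mathcal A$ differs by a $\mu$-null set from an element of the $\sigma$-algebra generated by $\mathcal T$ (equivalently, $\mathcal T$ differentiates $L^1(X,\mu)$: for every $f\in L^1(X,\mu)$ and $\mu$-almost every $x$, $\frac1{\mu(I)}\int_I f\,d\mu\to f(x)$ as $x\in I\in\mathcal T$, $\mu(I)\to0$). Let $p>1$ and $c\ge 1$ be real, and let $\phi\in L^1(X,\mu)$ be a non-negative function such that $$\frac1{\mu(I)}\int_I\phi^p\,d\mu\le c\left(\frac1{\mu(I)}\int_I\phi\,d\mu\right)^p\qquad\text{for every } I\in\mathcal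 T .$$ If $c>1$, then the equation $$\frac{p_0-p}{p_0}\left(\frac{p_0}{p_0-1}\right)^p (kc-k+1)=1$$ has exactly one root $p_0$ in $(p,\infty)$, and $\phi\in L^q(X,\mu)$ for every $q\in[p,p_0)$. If $c=1$ (when the equation has no root in $(p,\infty)$, and one reads $p_0=\infty$), then $\phi\in L^q(X,\mu)$ for every $q\in[p,\infty)$. -/

import Mathlib

open MeasureTheory

/-- A measure is non-atomic if every measurable set of positive measure has a measurable subset
of strictly smaller positive measure. (This is not the class `NoAtoms`, which only says that
points are null.) -/
def IsNonatomic {X : Type*} [MeasurableSpace X] (μ : Measure X) : Prop :=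
  ∀ A : Set X, MeasurableSet A → 0 < μ A →
    ∃ B : Set X, B ⊆ A ∧ MeasurableSet B ∧ 0 < μ B ∧ μ B < μ A

/-- The `m`-th generation of the family that starts from the whole space and in which a set `I`
has the set `C I` of children. -/
def treeLevel {X : Type*} (C : Set X → Set (Set X)) : ℕ → Set (Set X)
  | 0 => {Set.univ}
  | m + 1 => ⋃ I ∈ treeLevel C m, C I

/-- `T` is a `k`-homogeneous tree in which the children of `I ∈ T` are the elements of `C I`. -/
structure IsHomogeneousTreeWith {X : Type*} [MeasurableSpace X] (μ : Measure X) (k : ℕ)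
    (T : Set (Set X)) (C : Set X → Set (Set X)) : Prop where
  measurableSet : ∀ I ∈ T, MeasurableSet I
  univ_mem : Set.univ ∈ T
  children_mem : ∀ I ∈ T, C I ⊆ T
  card_children : ∀ I ∈ T, (C I).ncard = k
  children_subset : ∀ I ∈ T, ∀ J ∈ C I, J ⊆ I
  children_disjoint : ∀ I ∈ T, (C I).PairwiseDisjoint id
  sUnion_children : ∀ I ∈ T, ⋃₀ C I = I
  measure_children : ∀ I ∈ T, ∀ J ∈ C I, μ J = μ I / (k : ENNReal)
  /-- Every element of the tree is reached from the whole space by passing to children. -/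
  eq_iUnion_level : T = ⋃ m, treeLevel C m

/-- `T` is a `k`-homogeneous tree on `(X, μ)`, for some assignment of children. -/
def IsHomogeneousTree {X : Type*} [MeasurableSpace X] (μ : Measure X) (k : ℕ)
    (T : Set (Set X)) : Prop :=
  ∃ C : Set X → Set (Set X), IsHomogeneousTreeWith μ k T C

/-- Up to null sets, the family `T` generates the σ-algebra of the measure space. -/
def GeneratesModNull {X : Type*} [MeasurableSpace X] (μ : Measure X) (T : Set (Set X)) : Prop :=
  ∀ A : Set X, MeasurableSet A →
    ∃ B : Set X, MeasurableSet[MeasurableSpace.generateFrom T] B ∧ A =ᵐ[μ] B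

/-- The reverse Hölder inequality with exponent `p` and constant `c` on all elements of `T`,
`(1/μ(I)) ∫_I φ^p dμ ≤ c ((1/μ(I)) ∫_I φ dμ)^p`, for a non-negative `φ`. The averages are taken in
`[0, ∞]`, so the left side is `∞` where `φ^p` is not integrable. -/
def ReverseHolderOn {X : Type*} [MeasurableSpace X] (μ : Measure X) (T : Set (Set X))
    (p c : ℝ) (φ : X → ℝ) : Prop :=
  ∀ I ∈ T, ⨍⁻ x in I, ENNReal.ofReal (φ x) ^ p ∂μ ≤
    ENNReal.ofReal c * (⨍⁻ x in I, ENNReal.ofReal (φ x) ∂μ) ^ p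

/-- `p₀ > p` is a root of `((p₀ - p) / p₀) (p₀ / (p₀ - 1))^p K = 1`. -/
def IsCriticalExponent (p K p₀ : ℝ) : Prop :=
  p < p₀ ∧ (p₀ - p) / p₀ * (p₀ / (p₀ - 1)) ^ p * K = 1

/-! The core is an inequality at each level `τ > 0` with `τ ≥ ∫ φ`, from which the tree has
disappeared: `∫ (φ^p - τ^p)⁺ ≤ M τ^(p-1) ∫ (φ - τ)⁺` with `M = (K β^p - 1)/(β - 1)`, `K = kc - k +
1` and `β > 1` free (`integral_max_rpow_sub_le`). Stop the tree at the sets `I` whose average is at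
most `f = βτ` but which have a child with average above `f`. That child has measure `μ(I)/k`, so
`∫_I (φ - τ)⁺ ≥ (f - τ) μ(I)/k`, which pays for the reverse Hölder defect, at most `(c - 1) f^p
μ(I)`. Off the stopped sets `φ ≤ f` a.e., and there `x^p` is controlled by its chord over `[τ, f]`.

Multiplying by `τ^(q-p-1)` and integrating in `τ` bounds `∫ φ^q` as soon as `M (q - p) < p (q - 1)`
(`memLp_of_integral_max_rpow_sub_le`). For `β = r/(r - 1)`, the non-strict condition at `q = r` is
exactly `((r-p)/r) (r/(r-1))^p K ≤ 1`, and it becomes strict for `p < q < r`.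

In the variable `s = 1/p₀` the left side for `K = 1` decreases strictly from `1` at `0` to `0` at
`1/p`. This gives the unique root for `K > 1`, and for `K = 1` it makes every `r > p` admissible. -/

/-! ### Testing the sign of a function on a generating algebra -/

section SetAlgebra

open scoped symmDiff

theorem ae_nonpos_of_forall_setIntegral_nonpos_of_isSetAlgebra {X : Type*} [m : MeasurableSpace X]
    {μ : Measure X} [IsFiniteMeasure μ] {𝒜 : Set (Set X)} (h𝒜 : IsSetAlgebra 𝒜)
    (hm : ∀ A ∈ 𝒜, MeasurableSet A) (hgen : GeneratesModNull μ 𝒜) {ψ : X → ℝ}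
    (hψ : Integrable ψ μ) (hψ0 : ∀ A ∈ 𝒜, ∫ x in A, ψ x ∂μ ≤ 0) : ψ ≤ᵐ[μ] 0 := by
  have key : ∀ B, MeasurableSet B → ∫ x in B, ψ x ∂μ ≤ 0 := by
    intro B₀ hB₀
    obtain ⟨B, hB, hBB⟩ := hgen B₀ hB₀
    rw [setIntegral_congr_set hBB]
    have hle : MeasurableSpace.generateFrom 𝒜 ≤ m := MeasurableSpace.generateFrom_le hm
    have hfin : IsFiniteMeasure (μ.withDensity fun x => ‖ψ x‖ₑ) :=
      isFiniteMeasure_withDensity hψ.2.ne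
    refine le_of_forall_pos_le_add fun ε hε => ?_
    -- Approximation is done in the measure `|ψ| dμ`, so that the measure of the symmetric
    -- difference directly bounds the change of `∫ ψ`.
    have hdense := @Measure.MeasureDense.of_generateFrom_isSetAlgebra_finite X
      (MeasurableSpace.generateFrom 𝒜) ((μ.withDensity fun x => ‖ψ x‖ₑ).trim hle) 𝒜
      (isFiniteMeasure_trim hle) h𝒜 rfl
    obtain ⟨A, hA, hAB⟩ := @Measure.MeasureDense.approx X (MeasurableSpace.generateFrom 𝒜) _ _
      hdense B hB (by rw [trim_measurableSet_eq hle hB]; exact measure_ne_top _ _) ε hε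
    have hA' := hm A hA
    have hB' := hle B hB
    have hAm : MeasurableSet[MeasurableSpace.generateFrom 𝒜] A :=
      MeasurableSpace.measurableSet_generateFrom hA
    rw [trim_measurableSet_eq hle (hB.symmDiff hAm),
      withDensity_apply _ (hB'.symmDiff hA')] at hAB
    have h1 : ∫ x in B ∆ A, ‖ψ x‖ ∂μ < ε := by
      rw [integral_norm_eq_lintegral_enorm hψ.1.restrict]
      exact (ENNReal.lt_ofReal_iff_toReal_lt (ne_top_of_lt hAB)).1 hAB
    have h2 : ∫ x in B ∆ A, ‖ψ x‖ ∂μ = ∫ x in B \ A, ‖ψ x‖ ∂μ + ∫ x in A \ B, ‖ψ x‖ ∂μ :=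
      setIntegral_union disjoint_sdiff_sdiff (hA'.diff hB') hψ.norm.integrableOn
        hψ.norm.integrableOn
    have h3 := integral_inter_add_sdiff (μ := μ) (f := ψ) hA' (s := B) hψ.integrableOn
    have h4 := integral_inter_add_sdiff (μ := μ) (f := ψ) hB' (s := A) hψ.integrableOn
    have h5 := (abs_le.1 (norm_integral_le_integral_norm (μ := μ.restrict (B \ A)) ψ)).2
    have h6 := (abs_le.1 (norm_integral_le_integral_norm (μ := μ.restrict (A \ B)) ψ)).1
    have h7 := hψ0 A hA
    rw [Set.inter_comm] at h4
    linarith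
  have := ae_nonneg_of_forall_setIntegral_nonneg hψ.neg fun s hs _ => by
    simpa [integral_neg] using key s hs
  filter_upwards [this] with x hx
  simpa using hx

end SetAlgebra

theorem setIntegral_sUnion_nonpos {X : Type*} [MeasurableSpace X] {μ : Measure X}
    {F : Set (Set X)} (hF : F.Finite) (hm : ∀ I ∈ F, MeasurableSet I)
    (hd : F.PairwiseDisjoint id) {ψ : X → ℝ} (hψ : Integrable ψ μ)
    (h0 : ∀ I ∈ F, ∫ x in I, ψ x ∂μ ≤ 0) : ∫ x in ⋃₀ F, ψ x ∂μ ≤ 0 := by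
  lift F to Finset (Set X) using hF
  have := integral_biUnion_finset (μ := μ) (f := ψ) F (s := id) (fun I hI => hm I hI) hd
    fun _ _ => hψ.integrableOn
  rw [Set.sUnion_eq_biUnion]
  simp only [id, Finset.mem_coe] at this ⊢
  rw [this]
  exact Finset.sum_nonpos fun I hI => h0 I hI

/-! ### Generations of a tree -/

section TreeLevel

variable {X : Type*} {C : Set X → Set (Set X)}

theorem mem_treeLevel_succ {m : ℕ} {J : Set X} :
    J ∈ treeLevel C (m + 1) ↔ ∃ I ∈ treeLevel C m, J ∈ C I := by
  simp [treeLevel]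

theorem treeLevel_mono {C' : Set X → Set (Set X)} (h : ∀ I, C' I ⊆ C I) (m : ℕ) :
    treeLevel C' m ⊆ treeLevel C m := by
  induction m with
  | zero => exact subset_rfl
  | succ m ih =>
    intro J hJ
    obtain ⟨I, hI, hJI⟩ := mem_treeLevel_succ.1 hJ
    exact mem_treeLevel_succ.2 ⟨I, ih hI, h I hJI⟩

end TreeLevel

/-! ### Homogeneous trees and the stopping argument -/

namespace IsHomogeneousTreeWith

variable {X : Type*} [MeasurableSpace X] {μ : Measure X} {k : ℕ} {T : Set (Set X)}
  {C : Set X → Set (Set X)}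

theorem treeLevel_subset (h : IsHomogeneousTreeWith μ k T C) (m : ℕ) : treeLevel C m ⊆ T := by
  rw [h.eq_iUnion_level]
  exact Set.subset_iUnion _ m

theorem finite_children (h : IsHomogeneousTreeWith μ k T C) (hk : k ≠ 0) {I : Set X}
    (hI : I ∈ T) : (C I).Finite :=
  Set.finite_of_ncard_ne_zero (by rwa [h.card_children I hI])

theorem finite_treeLevel (h : IsHomogeneousTreeWith μ k T C) (hk : k ≠ 0) (m : ℕ) :
    (treeLevel C m).Finite := by
  induction m with
  | zero => exact Set.finite_singleton _
  | succ m ih => exact ih.biUnion fun I hI => h.finite_children hk (h.treeLevel_subset m hI)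

theorem pairwiseDisjoint_treeLevel (h : IsHomogeneousTreeWith μ k T C) (m : ℕ) :
    (treeLevel C m).PairwiseDisjoint id := by
  induction m with
  | zero => exact Set.pairwiseDisjoint_singleton _ _
  | succ m ih =>
    intro J hJ J' hJ' hne
    obtain ⟨I, hI, hJI⟩ := mem_treeLevel_succ.1 hJ
    obtain ⟨I', hI', hJI'⟩ := mem_treeLevel_succ.1 hJ'
    by_cases hII : I = I'
    · subst hII
      exact h.children_disjoint I (h.treeLevel_subset m hI) hJI hJI' hne
    · exact (ih hI hI' hII).mono (h.children_subset I (h.treeLevel_subset m hI) J hJI)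
        (h.children_subset I' (h.treeLevel_subset m hI') J' hJI')

theorem sUnion_biUnion_children (h : IsHomogeneousTreeWith μ k T C) {F : Set (Set X)}
    (hF : F ⊆ T) : ⋃₀ (⋃ I ∈ F, C I) = ⋃₀ F := by
  ext x
  simp only [Set.mem_sUnion, Set.mem_iUnion, exists_prop]
  constructor
  · rintro ⟨J, ⟨I, hI, hJ⟩, hx⟩
    exact ⟨I, hI, h.children_subset I (hF hI) J hJ hx⟩
  · rintro ⟨I, hI, hx⟩
    rw [← h.sUnion_children I (hF hI)] at hx
    obtain ⟨J, hJ, hx⟩ := hx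
    exact ⟨J, ⟨I, hI, hJ⟩, hx⟩

theorem sUnion_treeLevel (h : IsHomogeneousTreeWith μ k T C) (m : ℕ) :
    ⋃₀ treeLevel C m = Set.univ := by
  induction m with
  | zero => simp [treeLevel]
  | succ m ih => rw [← ih]; exact h.sUnion_biUnion_children (h.treeLevel_subset m)

/-- The sets that are unions of elements of the `m`-th generation of the tree. -/
def levelUnions (C : Set X → Set (Set X)) (m : ℕ) : Set (Set X) :=
  {A | ∃ F ⊆ treeLevel C m, A = ⋃₀ F}

theorem levelUnions_mono (h : IsHomogeneousTreeWith μ k T C) : Monotone (levelUnions C) := by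
  refine monotone_nat_of_le_succ fun m => ?_
  rintro A ⟨F, hF, rfl⟩
  exact ⟨⋃ I ∈ F, C I, Set.biUnion_mono hF fun _ _ => subset_rfl,
    (h.sUnion_biUnion_children (hF.trans (h.treeLevel_subset m))).symm⟩

theorem measurableSet_of_mem_levelUnions (h : IsHomogeneousTreeWith μ k T C) (hk : k ≠ 0) {m : ℕ}
    {A : Set X} (hA : A ∈ levelUnions C m) : MeasurableSet A := by
  obtain ⟨F, hF, rfl⟩ := hA
  exact MeasurableSet.sUnion ((h.finite_treeLevel hk m).subset hF).countable
    fun I hI => h.measurableSet I (h.treeLevel_subset m (hF hI))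

theorem isSetAlgebra_iUnion_levelUnions (h : IsHomogeneousTreeWith μ k T C) :
    IsSetAlgebra (⋃ m, levelUnions C m) where
  empty_mem := Set.mem_iUnion.2 ⟨0, ∅, Set.empty_subset _, by simp⟩
  compl_mem := by
    intro A hA
    obtain ⟨m, F, hF, rfl⟩ := Set.mem_iUnion.1 hA
    refine Set.mem_iUnion.2 ⟨m, treeLevel C m \ F, Set.sdiff_subset, ?_⟩
    have hu : ⋃₀ (treeLevel C m \ F) ∪ ⋃₀ F = Set.univ := by
      rw [← Set.sUnion_union, Set.sdiff_union_of_subset hF, h.sUnion_treeLevel]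
    have hd : Disjoint (⋃₀ (treeLevel C m \ F)) (⋃₀ F) := by
      rw [Set.disjoint_sUnion_left]
      intro I hI
      rw [Set.disjoint_sUnion_right]
      intro J hJ
      exact h.pairwiseDisjoint_treeLevel m hI.1 (hF hJ) fun e => hI.2 (e ▸ hJ)
    exact (IsCompl.of_eq hd.eq_bot hu).symm.compl_eq
  union_mem := by
    intro A B hA hB
    obtain ⟨m, hA⟩ := Set.mem_iUnion.1 hA
    obtain ⟨n, hB⟩ := Set.mem_iUnion.1 hB
    obtain ⟨F, hF, rfl⟩ := h.levelUnions_mono (le_max_left m n) hA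
    obtain ⟨G, hG, rfl⟩ := h.levelUnions_mono (le_max_right m n) hB
    exact Set.mem_iUnion.2 ⟨max m n, F ∪ G, Set.union_subset hF hG, (Set.sUnion_union F G).symm⟩

theorem generatesModNull_iUnion_levelUnions (h : IsHomogeneousTreeWith μ k T C)
    (hgen : GeneratesModNull μ T) : GeneratesModNull μ (⋃ m, levelUnions C m) := by
  intro A hA
  obtain ⟨B, hB, hAB⟩ := hgen A hA
  refine ⟨B, MeasurableSpace.generateFrom_mono ?_ B hB, hAB⟩
  rw [h.eq_iUnion_level]
  exact Set.iUnion_mono fun m I hI => ⟨{I}, by simpa using hI, by simp⟩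

/-- If `u ≤ 0` on average over `X`, then stopping at the first sets of the tree that have a child
over which `u` has positive average shows that `∫ v ≤ 0`, provided that `∫_I v ≤ 0` for each
stopped set `I` and that `v ≤ 0` where `u ≤ 0`. -/
theorem integral_nonpos_of_stopping (h : IsHomogeneousTreeWith μ k T C) (hk : k ≠ 0)
    [IsFiniteMeasure μ] (hgen : GeneratesModNull μ T) {u v : X → ℝ} (hu : Integrable u μ)
    (hv : Integrable v μ) (hu0 : ∫ x, u x ∂μ ≤ 0)
    (hleaf : ∀ I ∈ T, ∫ x in I, u x ∂μ ≤ 0 → ∀ J ∈ C I, 0 < ∫ x in J, u x ∂μ →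
      ∫ x in I, v x ∂μ ≤ 0)
    (hvu : ∀ x, u x ≤ 0 → v x ≤ 0) : ∫ x, v x ∂μ ≤ 0 := by
  classical
  -- The condition does not depend on `J`: either all children of `I` survive or none does, and in
  -- the latter case `I` is a stopped set.
  let C' : Set X → Set (Set X) := fun I => {J ∈ C I | ∀ J' ∈ C I, ∫ x in J', u x ∂μ ≤ 0}
  have hC' : ∀ I, C' I ⊆ C I := fun I J hJ => hJ.1
  have hlev : ∀ m, treeLevel C' m ⊆ treeLevel C m := treeLevel_mono hC'
  have hT : ∀ m, treeLevel C' m ⊆ T := fun m => (hlev m).trans (h.treeLevel_subset m)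
  have hfin : ∀ m, (treeLevel C' m).Finite := fun m => (h.finite_treeLevel hk m).subset (hlev m)
  have hdisj : ∀ m, (treeLevel C' m).PairwiseDisjoint id := fun m =>
    (h.pairwiseDisjoint_treeLevel m).subset (hlev m)
  have hu' : ∀ m, ∀ I ∈ treeLevel C' m, ∫ x in I, u x ∂μ ≤ 0 := by
    intro m I hI
    cases m with
    | zero =>
      obtain rfl : I = Set.univ := hI
      simpa using hu0
    | succ m =>
      obtain ⟨P, -, hP⟩ := mem_treeLevel_succ.1 hI
      exact hP.2 I hP.1
  let R : ℕ → Set X := fun m => ⋃₀ treeLevel C' m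
  have hRm : ∀ m, MeasurableSet (R m) := fun m =>
    MeasurableSet.sUnion (hfin m).countable fun I hI => h.measurableSet I (hT m hI)
  have hanti : Antitone R := by
    refine antitone_nat_of_succ_le fun m x hx => ?_
    obtain ⟨J, hJ, hx⟩ := hx
    obtain ⟨I, hI, hJI⟩ := mem_treeLevel_succ.1 hJ
    exact ⟨I, hI, h.children_subset I (hT m hI) J hJI.1 hx⟩
  -- What is lost from one generation to the next is a disjoint union of stopped sets, over each of
  -- which `v` has non-positive integral.
  have hstep : ∀ m, ∫ x in R m, v x ∂μ ≤ ∫ x in R (m + 1), v x ∂μ := by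
    intro m
    let S : Set (Set X) := {I ∈ treeLevel C' m | ∃ J ∈ C I, 0 < ∫ x in J, u x ∂μ}
    have hS : S ⊆ treeLevel C' m := fun I hI => hI.1
    have hR : R m \ R (m + 1) = ⋃₀ S := by
      ext x
      constructor
      · rintro ⟨⟨I, hI, hx⟩, hx'⟩
        refine ⟨I, ⟨hI, ?_⟩, hx⟩
        by_contra! hcon
        rw [← h.sUnion_children I (hT m hI)] at hx
        obtain ⟨J, hJ, hx⟩ := hx
        exact hx' ⟨J, mem_treeLevel_succ.2 ⟨I, hI, hJ, hcon⟩, hx⟩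
      · rintro ⟨I, ⟨hI, J, hJ, hpos⟩, hx⟩
        refine ⟨⟨I, hI, hx⟩, ?_⟩
        rintro ⟨J', hJ', hx'⟩
        obtain ⟨I', hI', hJI'⟩ := mem_treeLevel_succ.1 hJ'
        have hx'' := h.children_subset I' (hT m hI') J' hJI'.1 hx'
        obtain rfl : I = I' := by
          by_contra hne
          exact Set.disjoint_left.1 (hdisj m hI hI' hne) hx hx''
        exact (hJI'.2 J hJ).not_gt hpos
    have hsplit := setIntegral_sUnion_nonpos ((hfin m).subset hS)
      (fun I hI => h.measurableSet I (hT m (hS hI))) ((hdisj m).subset hS) hv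
      (fun I hI => by
        obtain ⟨hI, J, hJ, hpos⟩ := hI
        exact hleaf I (hT m hI) (hu' m I hI) J hJ hpos)
    have := integral_inter_add_sdiff (μ := μ) (f := v) (hRm (m + 1)) (s := R m) hv.integrableOn
    rw [Set.inter_eq_self_of_subset_right (hanti m.le_succ), hR] at this
    linarith
  have hmono : Monotone fun m => ∫ x in R m, v x ∂μ := monotone_nat_of_le_succ hstep
  have hR0 : R 0 = Set.univ := by simp [R, treeLevel]
  -- On the part that is never stopped, testing against unions of tree sets plays the role of the
  -- differentiation theorem.
  have hae : (⋂ m, R m).indicator u ≤ᵐ[μ] 0 := by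
    have hRi : MeasurableSet (⋂ m, R m) := MeasurableSet.iInter hRm
    refine ae_nonpos_of_forall_setIntegral_nonpos_of_isSetAlgebra
      h.isSetAlgebra_iUnion_levelUnions ?_ (h.generatesModNull_iUnion_levelUnions hgen)
      (hu.indicator hRi) ?_
    · intro A hA
      obtain ⟨m, hA⟩ := Set.mem_iUnion.1 hA
      exact h.measurableSet_of_mem_levelUnions hk hA
    · intro A hA
      obtain ⟨m, hA⟩ := Set.mem_iUnion.1 hA
      have hAm := h.measurableSet_of_mem_levelUnions hk hA
      rw [setIntegral_indicator hRi, Set.inter_iInter]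
      refine le_of_tendsto (tendsto_setIntegral_of_antitone (s := fun n => A ∩ R n)
        (fun n => hAm.inter (hRm n)) (fun a b hab => Set.inter_subset_inter_right _ (hanti hab))
        ⟨0, hu.integrableOn⟩) ?_
      -- From generation `m` on, `A ∩ R n` is a disjoint union of surviving sets, each with `∫ u ≤
      -- 0`.
      filter_upwards [Filter.eventually_ge_atTop m] with n hn
      obtain ⟨F, hF, rfl⟩ := h.levelUnions_mono hn hA
      have hFR : ⋃₀ F ∩ R n = ⋃₀ (F ∩ treeLevel C' n) := by
        ext x
        constructor
        · rintro ⟨⟨I, hI, hx⟩, ⟨J, hJ, hx'⟩⟩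
          obtain rfl : I = J := by
            by_contra hne
            exact Set.disjoint_left.1
              (h.pairwiseDisjoint_treeLevel n (hF hI) (hlev n hJ) hne) hx hx'
          exact ⟨I, ⟨hI, hJ⟩, hx⟩
        · rintro ⟨I, ⟨hI, hJ⟩, hx⟩
          exact ⟨⟨I, hI, hx⟩, ⟨I, hJ, hx⟩⟩
      rw [hFR]
      exact setIntegral_sUnion_nonpos ((hfin n).subset Set.inter_subset_right)
        (fun I hI => h.measurableSet I (hT n hI.2)) ((hdisj n).subset Set.inter_subset_right) hu
        fun I hI => hu' n I hI.2
  have hlim := tendsto_setIntegral_of_antitone hRm hanti ⟨0, hv.integrableOn⟩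
  have h0 : ∫ x in ⋂ m, R m, v x ∂μ ≤ 0 := by
    refine setIntegral_nonpos_of_ae_restrict ?_
    rw [Filter.EventuallyLE, ae_restrict_iff' (MeasurableSet.iInter hRm)]
    filter_upwards [hae] with x hx hxR
    rw [Set.indicator_of_mem hxR] at hx
    exact hvu x hx
  calc ∫ x, v x ∂μ = ∫ x in R 0, v x ∂μ := by rw [hR0, setIntegral_univ]
    _ ≤ ∫ x in ⋂ m, R m, v x ∂μ := hmono.ge_of_tendsto hlim 0
    _ ≤ 0 := h0

end IsHomogeneousTreeWith

/-! ### Convexity inequalities for `x ^ p` -/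

section Pointwise

/-- Tangent line of a convex function; this is Bernoulli's inequality rescaled by `y`. -/
theorem rpow_add_mul_sub_le_rpow {p x y : ℝ} (hp : 1 < p) (hx : 0 ≤ x) (hy : 0 ≤ y) :
    y ^ p + p * y ^ (p - 1) * (x - y) ≤ x ^ p := by
  rcases hy.eq_or_lt with rfl | hy
  · rw [Real.zero_rpow (by linarith), Real.zero_rpow (by linarith)]
    simpa using Real.rpow_nonneg hx p
  · have h := one_add_mul_self_le_rpow_one_add (s := x / y - 1)
      (by linarith [div_nonneg hx hy.le]) hp.le
    rw [add_sub_cancel, Real.div_rpow hx hy.le, le_div_iff₀ (Real.rpow_pos_of_pos hy p)] at h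
    refine le_trans (le_of_eq ?_) h
    rw [Real.rpow_sub_one hy.ne']
    field_simp

/-- The slope of the chord of `x ↦ x ^ p` over `[τ, f]`. -/
noncomputable def chordSlope (p τ f : ℝ) : ℝ := (f ^ p - τ ^ p) / (f - τ)

variable {p τ f : ℝ}

theorem mul_rpow_sub_one_le_chordSlope (hp : 1 < p) (hτ : 0 < τ) (hf : τ < f) :
    p * τ ^ (p - 1) ≤ chordSlope p τ f := by
  rw [chordSlope, le_div_iff₀ (by linarith)]
  linarith [rpow_add_mul_sub_le_rpow (x := f) hp (by linarith) hτ.le]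

theorem rpow_le_chord {x : ℝ} (hp : 1 < p) (hτ : 0 < τ) (hf : τ < f) (hx : τ ≤ x) (hxf : x ≤ f) :
    x ^ p ≤ τ ^ p + chordSlope p τ f * (x - τ) := by
  have h1 := rpow_add_mul_sub_le_rpow (x := τ) (y := x) hp (by linarith) (by linarith)
  have h2 := rpow_add_mul_sub_le_rpow (x := f) (y := x) hp (by linarith) (by linarith)
  have h3 := mul_le_mul_of_nonneg_left h1 (sub_nonneg.2 hxf)
  have h4 := mul_le_mul_of_nonneg_left h2 (sub_nonneg.2 hx)
  have hpos : 0 < f - τ := by linarith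
  have h5 : τ ^ p + chordSlope p τ f * (x - τ)
      = ((f - x) * τ ^ p + (x - τ) * f ^ p) / (f - τ) := by
    rw [chordSlope]
    field_simp
    ring
  rw [h5, le_div_iff₀ hpos]
  linarith

theorem chord_le_rpow {x : ℝ} (hp : 1 < p) (hτ : 0 < τ) (hf : τ < f) (hx0 : 0 ≤ x) (hx : x ≤ τ) :
    τ ^ p + chordSlope p τ f * (x - τ) ≤ x ^ p := by
  have h1 := rpow_add_mul_sub_le_rpow hp hx0 hτ.le
  have h2 := mul_le_mul_of_nonneg_right (mul_rpow_sub_one_le_chordSlope hp hτ hf)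
    (sub_nonneg.2 hx)
  linarith

/-- The difference between `x ^ p` and the convex function that agrees with it on `[0, τ]` and
continues beyond `τ` along the chord over `[τ, f]`. -/
noncomputable def chordExcess (p τ f x : ℝ) : ℝ :=
  max x τ ^ p - τ ^ p - chordSlope p τ f * (max x τ - τ)

theorem chordExcess_nonpos {x : ℝ} (hp : 1 < p) (hτ : 0 < τ) (hf : τ < f) (hx : x ≤ f) :
    chordExcess p τ f x ≤ 0 := by
  rw [chordExcess]
  linarith [rpow_le_chord hp hτ hf (le_max_right x τ) (max_le hx hf.le)]

/-- Let `g` be the convex function with `chordExcess = x^p - g`. A supporting line of `g` at `y` has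
some slope `s`, and `g(y) ≥ y^p` because `y ≤ f`. The slope is that of the power for `y ≤ τ` and
that of the chord for `y ≥ τ`. -/
theorem exists_chordExcess_le {y : ℝ} (hp : 1 < p) (hτ : 0 < τ) (hf : τ < f) (hy : 0 ≤ y)
    (hyf : y ≤ f) :
    ∃ s, ∀ x, 0 ≤ x → chordExcess p τ f x ≤ x ^ p - y ^ p - s * (x - y) := by
  rcases le_total y τ with hyτ | hyτ
  · refine ⟨p * y ^ (p - 1), fun x hx => ?_⟩
    rw [chordExcess]
    rcases le_total x τ with hxτ | hxτ
    · rw [max_eq_right hxτ]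
      linarith [rpow_add_mul_sub_le_rpow hp hx hy]
    · rw [max_eq_left hxτ]
      have h1 := rpow_add_mul_sub_le_rpow hp hτ.le hy
      have h2 : p * y ^ (p - 1) ≤ p * τ ^ (p - 1) := by gcongr
      have h3 := mul_le_mul_of_nonneg_right
        (h2.trans (mul_rpow_sub_one_le_chordSlope hp hτ hf)) (sub_nonneg.2 hxτ)
      linarith
  · refine ⟨chordSlope p τ f, fun x hx => ?_⟩
    have h1 := rpow_le_chord hp hτ hf hyτ hyf
    rw [chordExcess]
    rcases le_total x τ with hxτ | hxτ
    · rw [max_eq_right hxτ]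
      linarith [chord_le_rpow hp hτ hf hx hxτ]
    · rw [max_eq_left hxτ]
      linarith

theorem max_rpow_eq {x : ℝ} (hp : 0 ≤ p) (hx : 0 ≤ x) (hτ : 0 ≤ τ) :
    max x τ ^ p = max (x ^ p) (τ ^ p) := by
  rcases le_total x τ with h | h
  · rw [max_eq_right h, max_eq_right (Real.rpow_le_rpow hx h hp)]
  · rw [max_eq_left h, max_eq_left (Real.rpow_le_rpow hτ h hp)]

end Pointwise

/-! ### Real-valued forms of the reverse Hölder inequality -/

section ReverseHolder

variable {X : Type*} [MeasurableSpace X] {μ : Measure X} {T : Set (Set X)} {p c : ℝ} {φ : X → ℝ}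

/-- The averages live in `[0, ∞]`, so the inequality on the root already forces finiteness. -/
theorem integrable_rpow_of_reverseHolderOn [IsProbabilityMeasure μ] (hp : 1 < p)
    (hφ0 : ∀ x, 0 ≤ φ x) (hφ : Integrable φ μ) (hT : Set.univ ∈ T)
    (hRH : ReverseHolderOn μ T p c φ) : Integrable (fun x => φ x ^ p) μ := by
  have hp0 : 0 ≤ p := by linarith
  refine ⟨(hφ.1.aemeasurable.pow_const p).aestronglyMeasurable, ?_⟩
  rw [hasFiniteIntegral_iff_ofReal (ae_of_all _ fun x => Real.rpow_nonneg (hφ0 x) p)]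
  have h1 := hRH _ hT
  simp only [Measure.restrict_univ, laverage_eq_lintegral] at h1
  simp_rw [← ENNReal.ofReal_rpow_of_nonneg (hφ0 _) hp0]
  refine h1.trans_lt (ENNReal.mul_lt_top ENNReal.ofReal_lt_top
    (ENNReal.rpow_lt_top_of_nonneg hp0 ?_))
  exact ((hasFiniteIntegral_iff_ofReal (ae_of_all _ hφ0)).1 hφ.2).ne

theorem setIntegral_rpow_le_of_reverseHolderOn [IsFiniteMeasure μ] (hp : 1 < p) (hc : 0 ≤ c)
    (hφ0 : ∀ x, 0 ≤ φ x) (hφ : Integrable φ μ) (hφp : Integrable (fun x => φ x ^ p) μ)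
    (hRH : ReverseHolderOn μ T p c φ) {I : Set X} (hI : I ∈ T) :
    ∫ x in I, φ x ^ p ∂μ ≤ c * ((∫ x in I, φ x ∂μ) / μ.real I) ^ p * μ.real I := by
  have hp0 : 0 ≤ p := by linarith
  rcases eq_or_ne (μ I) 0 with h0 | h0
  · simp [Measure.restrict_eq_zero.2 h0, measureReal_def, h0]
  have hm : 0 < μ.real I := ENNReal.toReal_pos h0 (measure_ne_top _ _)
  have h1 := hRH I hI
  simp only [setLAverage_eq] at h1
  simp_rw [ENNReal.ofReal_rpow_of_nonneg (hφ0 _) hp0] at h1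
  rw [← ofReal_integral_eq_lintegral_ofReal hφ.integrableOn (ae_of_all _ hφ0),
    ← ofReal_integral_eq_lintegral_ofReal hφp.integrableOn
      (ae_of_all _ fun x => Real.rpow_nonneg (hφ0 x) p), ← ofReal_measureReal,
    ← ENNReal.ofReal_div_of_pos hm, ← ENNReal.ofReal_div_of_pos hm,
    ENNReal.ofReal_rpow_of_nonneg
      (div_nonneg (integral_nonneg hφ0) hm.le) hp0,
    ← ENNReal.ofReal_mul hc, ENNReal.ofReal_le_ofReal_iff
      (mul_nonneg hc (Real.rpow_nonneg (div_nonneg (integral_nonneg hφ0) hm.le) _)),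
    div_le_iff₀ hm] at h1
  exact h1

end ReverseHolder

/-! ### The inequality at a single level -/

section LevelInequality

variable {X : Type*} [MeasurableSpace X] {μ : Measure X} {k : ℕ} {T : Set (Set X)} {p c : ℝ}
  {φ : X → ℝ}

theorem integrable_max_sub [IsFiniteMeasure μ] (hφ : Integrable φ μ) (τ : ℝ) :
    Integrable (fun x => max (φ x) τ - τ) μ :=
  (hφ.sup (integrable_const τ)).sub (integrable_const τ)

theorem integrable_max_rpow_sub [IsFiniteMeasure μ] (hp : 1 < p) (hφ0 : ∀ x, 0 ≤ φ x)
    (hφp : Integrable (fun x => φ x ^ p) μ) {τ : ℝ} (hτ : 0 ≤ τ) :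
    Integrable (fun x => max (φ x) τ ^ p - τ ^ p) μ := by
  simp_rw [max_rpow_eq (zero_le_one.trans hp.le) (hφ0 _) hτ]
  exact integrable_max_sub hφp _

theorem integral_max_rpow_sub_le_of_lt [IsProbabilityMeasure μ] (hk : k ≠ 0)
    (hT : IsHomogeneousTree μ k T) (hgen : GeneratesModNull μ T) (hp : 1 < p) (hc : 1 ≤ c)
    (hφ0 : ∀ x, 0 ≤ φ x) (hφ : Integrable φ μ) (hRH : ReverseHolderOn μ T p c φ) {τ f : ℝ}
    (hτ : 0 < τ) (hf : τ < f) (hφf : ∫ x, φ x ∂μ ≤ f) :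
    ∫ x, (max (φ x) τ ^ p - τ ^ p) ∂μ ≤
      (chordSlope p τ f + (c - 1) * f ^ p * k / (f - τ)) * ∫ x, (max (φ x) τ - τ) ∂μ := by
  obtain ⟨C, h⟩ := hT
  -- Calibrated so that `D (f - τ) μ(J) = (c - 1) f^p μ(I)` for a child `J` of `I`.
  set D := (c - 1) * f ^ p * k / (f - τ) with hD
  have hfτ : 0 < f - τ := sub_pos.2 hf
  have hcf : 0 ≤ (c - 1) * f ^ p :=
    mul_nonneg (by linarith) (Real.rpow_nonneg (by linarith) p)
  have hD0 : 0 ≤ D := div_nonneg (mul_nonneg hcf k.cast_nonneg) hfτ.le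
  have hφp := integrable_rpow_of_reverseHolderOn hp hφ0 hφ h.univ_mem hRH
  have h1 := integrable_max_rpow_sub hp hφ0 hφp hτ.le
  have h2 := integrable_max_sub hφ τ
  have hG : Integrable (fun x => chordExcess p τ f (φ x)) μ := h1.sub (h2.const_mul _)
  have hpos : ∀ x, 0 ≤ max (φ x) τ - τ := fun x => sub_nonneg.2 (le_max_right _ _)
  have key : ∫ x, (chordExcess p τ f (φ x) - D * (max (φ x) τ - τ)) ∂μ ≤ 0 := by
    refine h.integral_nonpos_of_stopping hk hgen (u := fun x => φ x - f)
      (hφ.sub (integrable_const f)) (hG.sub (h2.const_mul D)) ?_ ?_ ?_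
    · rw [integral_sub hφ (integrable_const f)]
      simpa using hφf
    · intro I hI hIf J hJ hJf
      rw [integral_sub hφ.integrableOn (integrable_const f), setIntegral_const, smul_eq_mul]
        at hIf hJf
      rw [integral_sub hG.integrableOn (h2.const_mul D).integrableOn, integral_const_mul]
      have hmJ : μ.real I = k * μ.real J := by
        have hk' : (k : ℝ) ≠ 0 := Nat.cast_ne_zero.2 hk
        rw [measureReal_def μ J, h.measure_children I hI J hJ, ENNReal.toReal_div,
          ENNReal.toReal_natCast, measureReal_def]
        field_simp
      have hJ1 : (f - τ) * μ.real J ≤ ∫ x in J, (max (φ x) τ - τ) ∂μ := by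
        have : ∫ x in J, (φ x - τ) ∂μ ≤ ∫ x in J, (max (φ x) τ - τ) ∂μ :=
          integral_mono (hφ.sub (integrable_const τ)).integrableOn h2.integrableOn
            fun x => sub_le_sub_right (le_max_left _ _) _
        rw [integral_sub hφ.integrableOn (integrable_const τ), setIntegral_const,
          smul_eq_mul] at this
        linarith
      have hJ2 : ∫ x in J, (max (φ x) τ - τ) ∂μ ≤ ∫ x in I, (max (φ x) τ - τ) ∂μ :=
        setIntegral_mono_set h2.integrableOn (ae_of_all _ hpos)
          (Filter.Eventually.of_forall (h.children_subset I hI J hJ))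
      have hDI : (c - 1) * f ^ p * μ.real I ≤ D * ∫ x in I, (max (φ x) τ - τ) ∂μ := by
        calc (c - 1) * f ^ p * μ.real I = D * ((f - τ) * μ.real J) := by
              rw [hmJ, hD]; field_simp
          _ ≤ _ := mul_le_mul_of_nonneg_left (hJ1.trans hJ2) hD0
      set y := (∫ x in I, φ x ∂μ) / μ.real I with hy
      have hy0 : 0 ≤ y := div_nonneg (integral_nonneg hφ0) measureReal_nonneg
      have hym : y * μ.real I = ∫ x in I, φ x ∂μ := by
        rcases eq_or_ne (μ I) 0 with h0 | h0
        · simp [Measure.restrict_eq_zero.2 h0, measureReal_def, h0]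
        · exact div_mul_cancel₀ _ (ENNReal.toReal_pos h0 (measure_ne_top _ _)).ne'
      have hyf : y ≤ f := by
        refine div_le_of_le_mul₀ measureReal_nonneg (by linarith) ?_
        linarith
      -- Since `y` is the average of `φ` over `I`, the linear term integrates to zero, and what
      -- remains is `∫_I φ^p - y^p μ(I) ≤ (c - 1) y^p μ(I)`.
      obtain ⟨s, hs⟩ := exists_chordExcess_le hp hτ hf hy0 hyf
      have h3 : Integrable (fun x => φ x ^ p - y ^ p) μ := hφp.sub (integrable_const _)
      have h4 : Integrable (fun x => s * (φ x - y)) μ :=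
        (hφ.sub (integrable_const y)).const_mul s
      have hsI : ∫ x in I, chordExcess p τ f (φ x) ∂μ ≤
          ∫ x in I, (φ x ^ p - y ^ p - s * (φ x - y)) ∂μ :=
        integral_mono hG.integrableOn (h3.sub h4).integrableOn fun x => hs _ (hφ0 x)
      rw [integral_sub h3.integrableOn h4.integrableOn,
        integral_sub hφp.integrableOn (integrable_const _), integral_const_mul,
        integral_sub hφ.integrableOn (integrable_const _), setIntegral_const, setIntegral_const,
        smul_eq_mul, smul_eq_mul, ← hym] at hsI
      have hRI := setIntegral_rpow_le_of_reverseHolderOn hp (by linarith) hφ0 hφ hφp hRH hI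
      rw [← hy] at hRI
      have hyp : (c - 1) * y ^ p * μ.real I ≤ (c - 1) * f ^ p * μ.real I :=
        mul_le_mul_of_nonneg_right (mul_le_mul_of_nonneg_left
          (Real.rpow_le_rpow hy0 hyf (by linarith)) (by linarith)) measureReal_nonneg
      linarith
    · intro x hx
      have := chordExcess_nonpos hp hτ hf (x := φ x) (by linarith)
      have := mul_nonneg hD0 (hpos x)
      linarith
  rw [integral_sub hG (h2.const_mul D), integral_const_mul] at key
  simp only [chordExcess] at key
  rw [integral_sub h1 (h2.const_mul _), integral_const_mul] at key
  linarith

/-- Choosing `f = βτ` makes the constant homogeneous in `τ`: the chord contributes `β^p - 1` and the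
defect `k (c - 1) β^p`, both over `β - 1`. -/
theorem integral_max_rpow_sub_le [IsProbabilityMeasure μ] (hk : k ≠ 0)
    (hT : IsHomogeneousTree μ k T) (hgen : GeneratesModNull μ T) (hp : 1 < p) (hc : 1 ≤ c)
    (hφ0 : ∀ x, 0 ≤ φ x) (hφ : Integrable φ μ) (hRH : ReverseHolderOn μ T p c φ) {τ β : ℝ}
    (hτ : 0 < τ) (hβ : 1 < β) (hφτ : ∫ x, φ x ∂μ ≤ τ) :
    ∫ x, (max (φ x) τ ^ p - τ ^ p) ∂μ ≤
      (((k : ℝ) * c - k + 1) * β ^ p - 1) / (β - 1) * τ ^ (p - 1) *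
        ∫ x, (max (φ x) τ - τ) ∂μ := by
  have hlt : τ < β * τ := by nlinarith
  refine (integral_max_rpow_sub_le_of_lt hk hT hgen hp hc hφ0 hφ hRH hτ hlt
    (hφτ.trans hlt.le)).trans_eq ?_
  congr 1
  have h1 : β - 1 ≠ 0 := by linarith
  have h2 : β * τ - τ ≠ 0 := by linarith
  rw [chordSlope, Real.mul_rpow (by linarith) hτ.le, Real.rpow_sub_one hτ.ne',
    show β * τ - τ = (β - 1) * τ by ring]
  field_simp
  ring

end LevelInequality

/-! ### Integration over the levels, at a fixed value of the function -/

section LevelIntegral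

variable {p q M τ₀ : ℝ}

/-- The integrand `τ ^ (q - p - 1) (x ^ p - τ ^ p)⁺ - M τ ^ (q - 2) (x - τ)⁺`. -/
noncomputable def levelIntegrand (p q M τ x : ℝ) : ℝ :=
  τ ^ (q - p - 1) * (max x τ ^ p - τ ^ p) - M * τ ^ (q - 2) * (max x τ - τ)

theorem levelIntegrand_eq_zero {τ x : ℝ} (h : x ≤ τ) : levelIntegrand p q M τ x = 0 := by
  simp [levelIntegrand, max_eq_right h]

theorem continuousOn_levelIntegrand (hp : 1 < p) (x : ℝ) :
    ContinuousOn (fun τ => levelIntegrand p q M τ x) (Set.Ioi 0) := by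
  have h : ∀ r : ℝ, ContinuousOn (fun τ : ℝ => τ ^ r) (Set.Ioi 0) := fun r τ hτ =>
    (Real.continuousAt_rpow_const τ r (Or.inl (ne_of_gt hτ))).continuousWithinAt
  have hm : ContinuousOn (fun τ : ℝ => max x τ) (Set.Ioi 0) := by fun_prop
  exact ((h _).mul ((hm.rpow_const fun _ _ => Or.inr (by linarith)).sub (h _))).sub
    ((continuousOn_const.mul (h _)).mul (hm.sub continuousOn_id))

theorem intervalIntegrable_levelIntegrand {a b : ℝ} (hp : 1 < p) (ha : 0 < a) (hb : 0 < b)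
    (x : ℝ) : IntervalIntegrable (fun τ => levelIntegrand p q M τ x) volume a b :=
  ((continuousOn_levelIntegrand hp x).mono fun _ hτ =>
    (lt_min ha hb).trans_le hτ.1).intervalIntegrable

theorem integral_levelIntegrand_of_le {m x : ℝ} (hp : 1 < p) (hq : p < q) (hτ₀ : 0 < τ₀)
    (hm : τ₀ ≤ m) (hx : m ≤ x) :
    ∫ τ in τ₀..m, levelIntegrand p q M τ x =
      (x ^ p * m ^ (q - p) / (q - p) + (M - 1) * m ^ q / q - M * x * m ^ (q - 1) / (q - 1)) -
      (x ^ p * τ₀ ^ (q - p) / (q - p) + (M - 1) * τ₀ ^ q / q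
        - M * x * τ₀ ^ (q - 1) / (q - 1)) := by
  refine intervalIntegral.integral_eq_sub_of_hasDerivAt
    (f := fun τ => x ^ p * τ ^ (q - p) / (q - p) + (M - 1) * τ ^ q / q
      - M * x * τ ^ (q - 1) / (q - 1)) ?_
    (intervalIntegrable_levelIntegrand hp hτ₀ (hτ₀.trans_le hm) x)
  intro τ hτ
  rw [Set.uIcc_of_le hm] at hτ
  have hτ0 : 0 < τ := hτ₀.trans_le hτ.1
  have hd : ∀ r : ℝ, HasDerivAt (fun τ : ℝ => τ ^ r) (r * τ ^ (r - 1)) τ := fun r =>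
    Real.hasDerivAt_rpow_const (Or.inl hτ0.ne')
  have h := ((((hd (q - p)).const_mul (x ^ p)).div_const (q - p)).add
    (((hd q).const_mul (M - 1)).div_const q)).sub
    (((hd (q - 1)).const_mul (M * x)).div_const (q - 1))
  refine h.congr_deriv ?_
  have h1 : q - p ≠ 0 := by linarith
  have h2 : q ≠ 0 := by linarith
  have h3 : q - 1 ≠ 0 := by linarith
  have e1 : τ ^ (q - 1) = τ ^ (q - p - 1) * τ ^ p := by
    rw [← Real.rpow_add hτ0]; ring_nf
  have e2 : τ ^ (q - 1) = τ ^ (q - 2) * τ := by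
    rw [← Real.rpow_add_one hτ0.ne']; ring_nf
  have e3 : q - 1 - 1 = q - 2 := by ring
  rw [levelIntegrand, max_eq_left (hτ.2.trans hx), e3]
  field_simp
  linear_combination (M : ℝ) * e2 - e1

theorem le_integral_levelIntegrand (hp : 1 < p) (hq : p < q) (hM : 0 ≤ M)
    (hMq : M * (q - p) < p * (q - 1)) (hτ₀ : 0 < τ₀) :
    ∃ δ > 0, ∃ K, ∀ x N, 0 ≤ x → τ₀ ≤ N →
      δ * min x N ^ q - K * (x ^ p + 1) ≤ ∫ τ in τ₀..N, levelIntegrand p q M τ x := by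
  have hqp : 0 < q - p := by linarith
  have hq1 : 0 < q - 1 := by linarith
  have hq0 : 0 < q := by linarith
  have hA : 0 < p / (q - p) - M / (q - 1) := by
    rw [sub_pos, div_lt_div_iff₀ hq1 hqp]; exact hMq
  -- The coefficient of `m^q` in the antiderivative at `τ = m` when `x = m`.
  set δ := (p / (q - p) - M / (q - 1)) / q with hδ
  have hδ0 : 0 < δ := div_pos hA hq0
  have ha0 : 0 ≤ τ₀ ^ (q - p) / (q - p) := by positivity
  have hb0 : 0 ≤ M * τ₀ ^ q / q := by positivity
  have hc0 : 0 ≤ δ * τ₀ ^ q := by positivity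
  refine ⟨δ, hδ0, τ₀ ^ (q - p) / (q - p) + M * τ₀ ^ q / q + δ * τ₀ ^ q, fun x N hx hN => ?_⟩
  have hxp : 0 ≤ x ^ p := Real.rpow_nonneg hx p
  have hN0 : 0 < N := hτ₀.trans_le hN
  rcases le_or_gt x τ₀ with hxτ | hxτ
  · have h0 : ∫ τ in τ₀..N, levelIntegrand p q M τ x = 0 := by
      rw [intervalIntegral.integral_congr (g := fun _ => 0), intervalIntegral.integral_zero]
      intro τ hτ
      rw [Set.uIcc_of_le hN] at hτ
      exact levelIntegrand_eq_zero (hxτ.trans hτ.1)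
    rw [h0]
    have h1 : δ * min x N ^ q ≤ δ * τ₀ ^ q := by
      gcongr
      exact (min_le_left _ _).trans hxτ
    nlinarith [mul_nonneg ha0 hxp, mul_nonneg hb0 hxp, mul_nonneg hc0 hxp]
  · set m := min x N with hm
    have hmτ : τ₀ ≤ m := le_min hxτ.le hN
    have hm0 : 0 < m := hτ₀.trans_le hmτ
    have hmx : m ≤ x := min_le_left _ _
    have hmN : m ≤ N := min_le_right _ _
    have h0 : ∫ τ in m..N, levelIntegrand p q M τ x = 0 := by
      rcases le_total x N with hxN | hxN
      · rw [intervalIntegral.integral_congr (g := fun _ => 0), intervalIntegral.integral_zero]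
        intro τ hτ
        rw [Set.uIcc_of_le hmN, hm, min_eq_left hxN] at hτ
        exact levelIntegrand_eq_zero hτ.1
      · rw [hm, min_eq_right hxN, intervalIntegral.integral_same]
    rw [← intervalIntegral.integral_add_adjacent_intervals
      (intervalIntegrable_levelIntegrand hp hτ₀ hm0 x)
      (intervalIntegrable_levelIntegrand hp hm0 hN0 x), h0, add_zero,
      integral_levelIntegrand_of_le hp hq hτ₀ hmτ hmx]
    -- When the truncation is active, `x > m`. Linearising `x^p` at `m` turns the surplus into `x/m
    -- - 1` times the positive quantity `p/(q-p) - M/(q-1)`.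
    have hbern : m ^ p * (1 + p * (x / m - 1)) ≤ x ^ p := by
      refine le_trans (le_of_eq ?_) (rpow_add_mul_sub_le_rpow hp hx hm0.le)
      rw [Real.rpow_sub_one hm0.ne']
      field_simp
    have hr : 0 ≤ x / m - 1 := by
      rw [sub_nonneg, one_le_div hm0]; exact hmx
    have e1 : m ^ q = m ^ p * m ^ (q - p) := by rw [← Real.rpow_add hm0]; ring_nf
    have e2 : x * m ^ (q - 1) = m ^ q * (x / m) := by
      rw [Real.rpow_sub_one hm0.ne']; field_simp
    have h1 : m ^ q * (1 + p * (x / m - 1)) / (q - p) ≤ x ^ p * m ^ (q - p) / (q - p) := by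
      rw [e1]
      have := mul_le_mul_of_nonneg_right hbern (Real.rpow_nonneg hm0.le (q - p))
      exact div_le_div_of_nonneg_right (by linarith) hqp.le
    have h2 : m ^ q * (1 + p * (x / m - 1)) / (q - p) + (M - 1) * m ^ q / q
        - M * x * m ^ (q - 1) / (q - 1)
        = δ * m ^ q + (x / m - 1) * m ^ q * (p / (q - p) - M / (q - 1)) := by
      rw [mul_assoc M x, e2, hδ]
      field_simp
      ring
    have h3 : 0 ≤ (x / m - 1) * m ^ q * (p / (q - p) - M / (q - 1)) := by positivity
    have h4 : 0 ≤ M * x * τ₀ ^ (q - 1) / (q - 1) := by positivity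
    have h5 : (M - 1) * τ₀ ^ q / q ≤ M * τ₀ ^ q / q := by
      gcongr; linarith
    have h6 : x ^ p * τ₀ ^ (q - p) / (q - p) = τ₀ ^ (q - p) / (q - p) * x ^ p := by ring
    nlinarith [mul_nonneg hb0 hxp, mul_nonneg hc0 hxp]

end LevelIntegral

/-! ### From the level inequalities to `L^q` -/

section HigherIntegrability

variable {X : Type*} [MeasurableSpace X] {μ : Measure X} {p q M τ₀ : ℝ}
  {φ : X → ℝ}

theorem integrable_levelIntegrand (hp : 1 < p) (hM : 0 ≤ M) (hφ0 : ∀ x, 0 ≤ φ x)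
    (hφ : Integrable φ μ) (hφp : Integrable (fun x => φ x ^ p) μ) {N : ℝ} (hτ₀ : 0 < τ₀)
    (hN : τ₀ ≤ N) :
    Integrable (Function.uncurry fun τ x => levelIntegrand p q M τ (φ x))
      ((volume.restrict (Set.uIoc τ₀ N)).prod μ) := by
  have hw : ∀ r : ℝ, Integrable (fun τ : ℝ => τ ^ r) (volume.restrict (Set.uIoc τ₀ N)) := by
    intro r
    refine (intervalIntegral.intervalIntegrable_rpow (Or.inr ?_)).def'
    rw [Set.uIcc_of_le hN]
    exact fun h => hτ₀.not_ge h.1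
  have hbound := ((hw (q - p - 1)).mul_prod hφp).add (((hw (q - 2)).mul_prod hφ).const_mul M)
  refine hbound.mono' ?_ ?_
  · have h1 : AEMeasurable (fun z : ℝ × X => φ z.2)
        ((volume.restrict (Set.uIoc τ₀ N)).prod μ) := hφ.1.aemeasurable.comp_snd
    have h2 : Measurable fun z : ℝ × ℝ => levelIntegrand p q M z.1 z.2 := by
      unfold levelIntegrand
      fun_prop
    exact (h2.comp_aemeasurable (measurable_fst.aemeasurable.prodMk h1)).aestronglyMeasurable
  · have hae : ∀ᵐ z ∂(volume.restrict (Set.uIoc τ₀ N)).prod μ, τ₀ < z.1 := by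
      refine Measure.quasiMeasurePreserving_fst.ae (p := fun τ => τ₀ < τ) ?_
      rw [Set.uIoc_of_le hN]
      filter_upwards [ae_restrict_mem measurableSet_Ioc] with τ hτ using hτ.1
    filter_upwards [hae] with z hz
    obtain ⟨τ, x⟩ := z
    have hτ : 0 < τ := hτ₀.trans hz
    have hx := hφ0 x
    have hxp := Real.rpow_nonneg hx p
    have hτp := Real.rpow_nonneg hτ.le p
    have a1 : |max (φ x) τ ^ p - τ ^ p| ≤ φ x ^ p := by
      rw [max_rpow_eq (by linarith) hx hτ.le, abs_of_nonneg (sub_nonneg.2 (le_max_right _ _)),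
        sub_le_iff_le_add]
      exact max_le (by linarith) (by linarith)
    have a2 : |max (φ x) τ - τ| ≤ φ x := by
      rw [abs_of_nonneg (sub_nonneg.2 (le_max_right _ _)), sub_le_iff_le_add]
      exact max_le (by linarith) (by linarith)
    simp only [Function.uncurry_apply_pair, Pi.add_apply, levelIntegrand, Real.norm_eq_abs]
    refine (abs_sub _ _).trans (add_le_add ?_ ?_)
    · rw [abs_mul, abs_of_nonneg (Real.rpow_nonneg hτ.le _)]
      gcongr
    · rw [abs_mul, abs_of_nonneg (by positivity), mul_assoc]
      gcongr

/-- Fubini exchanges the pointwise lower bound with the level inequalities. The truncation at `N`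
keeps every integral finite, and the resulting bound depends only on `∫ (φ^p + 1)`. -/
theorem exists_integral_min_rpow_le [IsFiniteMeasure μ] (hp : 1 < p) (hq : p < q) (hM : 0 ≤ M)
    (hMq : M * (q - p) < p * (q - 1)) (hφ0 : ∀ x, 0 ≤ φ x) (hφ : Integrable φ μ)
    (hφp : Integrable (fun x => φ x ^ p) μ) (hτ₀ : 0 < τ₀)
    (hlevel : ∀ τ, τ₀ ≤ τ → ∫ x, (max (φ x) τ ^ p - τ ^ p) ∂μ ≤
      M * τ ^ (p - 1) * ∫ x, (max (φ x) τ - τ) ∂μ) :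
    ∃ B, ∀ N, τ₀ ≤ N → ∫ x, min (φ x) N ^ q ∂μ ≤ B := by
  obtain ⟨δ, hδ, K, hK⟩ := le_integral_levelIntegrand hp hq hM hMq hτ₀
  refine ⟨(∫ x, K * (φ x ^ p + 1) ∂μ) / δ, fun N hN => ?_⟩
  have hN0 : 0 < N := hτ₀.trans_le hN
  have hint := integrable_levelIntegrand (q := q) hp hM hφ0 hφ hφp hτ₀ hN
  have hint' := hint.integral_prod_right
  have hmin : Integrable (fun x => min (φ x) N ^ q) μ := by
    refine (integrable_const (N ^ q)).mono'
      ((hφ.1.aemeasurable.min aemeasurable_const).pow_const q).aestronglyMeasurable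
      (ae_of_all _ fun x => ?_)
    have h0 : 0 ≤ min (φ x) N := le_min (hφ0 x) hN0.le
    rw [Real.norm_of_nonneg (Real.rpow_nonneg h0 q)]
    exact Real.rpow_le_rpow h0 (min_le_right _ _) (by linarith)
  have hKi : Integrable (fun x => K * (φ x ^ p + 1)) μ :=
    (hφp.add (integrable_const 1)).const_mul K
  have h1 : ∫ x, (δ * min (φ x) N ^ q - K * (φ x ^ p + 1)) ∂μ ≤
      ∫ x, (∫ τ in τ₀..N, levelIntegrand p q M τ (φ x)) ∂μ := by
    refine integral_mono ((hmin.const_mul δ).sub hKi) ?_ fun x => hK (φ x) N (hφ0 x) hN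
    simpa only [intervalIntegral.integral_of_le hN, Set.uIoc_of_le hN, Function.uncurry_apply_pair]
      using hint'
  rw [← intervalIntegral_integral_swap hint] at h1
  have h2 : ∫ τ in τ₀..N, ∫ x, levelIntegrand p q M τ (φ x) ∂μ ≤ 0 := by
    rw [← neg_nonneg, ← intervalIntegral.integral_neg]
    refine intervalIntegral.integral_nonneg hN fun τ hτ => neg_nonneg.2 ?_
    have hτ0 : 0 < τ := hτ₀.trans_le hτ.1
    simp only [levelIntegrand]
    rw [integral_sub ((integrable_max_rpow_sub hp hφ0 hφp hτ0.le).const_mul _)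
      ((integrable_max_sub hφ τ).const_mul _), integral_const_mul, integral_const_mul]
    have := mul_le_mul_of_nonneg_left (hlevel τ hτ.1) (Real.rpow_nonneg hτ0.le (q - p - 1))
    have e : τ ^ (q - 2) = τ ^ (q - p - 1) * τ ^ (p - 1) := by
      rw [← Real.rpow_add hτ0]; ring_nf
    rw [e]
    linarith
  rw [integral_sub (hmin.const_mul δ) hKi, integral_const_mul] at h1
  rw [le_div_iff₀ hδ]
  linarith

theorem memLp_of_integral_max_rpow_sub_le [IsFiniteMeasure μ] (hp : 1 < p) (hq : p < q) (hM : 0 ≤ M)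
    (hMq : M * (q - p) < p * (q - 1)) (hφ0 : ∀ x, 0 ≤ φ x) (hφ : Integrable φ μ)
    (hφp : Integrable (fun x => φ x ^ p) μ) (hτ₀ : 0 < τ₀)
    (hlevel : ∀ τ, τ₀ ≤ τ → ∫ x, (max (φ x) τ ^ p - τ ^ p) ∂μ ≤
      M * τ ^ (p - 1) * ∫ x, (max (φ x) τ - τ) ∂μ) :
    MemLp φ (ENNReal.ofReal q) μ := by
  obtain ⟨B, hB⟩ := exists_integral_min_rpow_le hp hq hM hMq hφ0 hφ hφp hτ₀ hlevel
  have hq0 : 0 < q := by linarith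
  refine ⟨hφ.1, ?_⟩
  rw [eLpNorm_lt_top_iff_lintegral_rpow_enorm_lt_top (by simpa using hq0) ENNReal.ofReal_ne_top,
    ENNReal.toReal_ofReal hq0.le]
  have hmeas : ∀ n : ℕ, AEMeasurable
      (fun x => ENNReal.ofReal (min (φ x) (τ₀ + n) ^ q)) μ := fun n =>
    ((hφ.1.aemeasurable.min aemeasurable_const).pow_const q).ennreal_ofReal
  have hle : ∀ n : ℕ, ∫⁻ x, ENNReal.ofReal (min (φ x) (τ₀ + n) ^ q) ∂μ ≤ ENNReal.ofReal B := by
    intro n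
    have hn : τ₀ ≤ τ₀ + n := le_add_of_nonneg_right n.cast_nonneg
    have h0 : ∀ x, 0 ≤ min (φ x) (τ₀ + n) := fun x => le_min (hφ0 x) (hτ₀.le.trans hn)
    rw [← ofReal_integral_eq_lintegral_ofReal _ (ae_of_all _ fun x => Real.rpow_nonneg (h0 x) q)]
    · exact ENNReal.ofReal_le_ofReal (hB _ hn)
    · refine (integrable_const ((τ₀ + n) ^ q)).mono'
        ((hφ.1.aemeasurable.min aemeasurable_const).pow_const q).aestronglyMeasurable
        (ae_of_all _ fun x => ?_)
      rw [Real.norm_of_nonneg (Real.rpow_nonneg (h0 x) q)]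
      exact Real.rpow_le_rpow (h0 x) (min_le_right _ _) hq0.le
  have hlim : ∀ x, ‖φ x‖ₑ ^ q = Filter.liminf
      (fun n : ℕ => ENNReal.ofReal (min (φ x) (τ₀ + n) ^ q)) Filter.atTop := by
    intro x
    refine (Filter.Tendsto.liminf_eq (Filter.Tendsto.congr' ?_ tendsto_const_nhds)).symm
    obtain ⟨n₀, hn₀⟩ := exists_nat_ge (φ x)
    filter_upwards [Filter.eventually_ge_atTop n₀] with n hn
    have hn' : (n₀ : ℝ) ≤ n := Nat.cast_le.2 hn
    rw [min_eq_left (by linarith), Real.enorm_of_nonneg (hφ0 x),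
      ENNReal.ofReal_rpow_of_nonneg (hφ0 x) hq0.le]
  simp_rw [hlim]
  -- Fatou's lemma removes the truncation.
  calc _ ≤ _ := lintegral_liminf_le' hmeas
    _ ≤ ENNReal.ofReal B :=
      Filter.liminf_le_of_le (by isBoundedDefault) fun b hb => by
        obtain ⟨n, hn⟩ := hb.exists
        exact hn.trans (hle n)
    _ < ⊤ := ENNReal.ofReal_lt_top

end HigherIntegrability

/-! ### The critical equation -/

section CriticalExponent

variable {p : ℝ}

/-- The left side of the critical equation for `K = 1`, as a function of `s = 1 / p₀`. -/
noncomputable def criticalRatio (p s : ℝ) : ℝ := (1 - p * s) / (1 - s) ^ p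

theorem criticalRatio_inv {x : ℝ} (hx : 1 < x) :
    criticalRatio p x⁻¹ = (x - p) / x * (x / (x - 1)) ^ p := by
  have h0 : 0 < x := by linarith
  have h1 : 0 < x - 1 := by linarith
  have e : 1 - x⁻¹ = (x / (x - 1))⁻¹ := by field_simp
  rw [criticalRatio, e, Real.inv_rpow (by positivity), div_inv_eq_mul]
  congr 1
  field_simp

/-- Write `1 - t = (1 - s)(1 - d)`. Strict Bernoulli gives `(1 - d)^p > 1 - pd`, and `(1 - ps)(1 -
pd)` exceeds `1 - pt` by `p (p - 1) s d ≥ 0`. -/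
theorem criticalRatio_lt {s t : ℝ} (hp : 1 < p) (hs : 0 ≤ s) (hst : s < t) (ht : t < p⁻¹) :
    criticalRatio p t < criticalRatio p s := by
  have hp1 : p⁻¹ < 1 := inv_lt_one_of_one_lt₀ hp
  have hs1 : 0 < 1 - s := by linarith
  have ht1 : 0 < 1 - t := by linarith
  have hps : 0 < 1 - p * s := by
    have : p * s < p * p⁻¹ := mul_lt_mul_of_pos_left (hst.trans ht) (by linarith)
    rw [mul_inv_cancel₀ (by linarith)] at this
    linarith
  set d := (t - s) / (1 - s) with hd
  have hd0 : 0 < d := div_pos (by linarith) hs1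
  have hds : d * (1 - s) = t - s := div_mul_cancel₀ _ hs1.ne'
  have hd1 : d ≤ 1 := by rw [hd, div_le_one hs1]; linarith
  have e : 1 - t = (1 - s) * (1 - d) := by linarith
  have hb := one_add_mul_self_lt_rpow_one_add (s := -d) (by linarith) (by linarith) hp
  rw [← sub_eq_add_neg] at hb
  have h0 : 0 < (1 - s) ^ p := Real.rpow_pos_of_pos hs1 p
  rw [criticalRatio, criticalRatio, div_lt_div_iff₀ (Real.rpow_pos_of_pos ht1 p) h0, e,
    Real.mul_rpow hs1.le (by nlinarith)]
  have h1 : 1 - p * t ≤ (1 - p * s) * (1 - p * d) := by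
    nlinarith [mul_nonneg (mul_nonneg (sub_nonneg.2 hp.le) hs) hd0.le]
  have h2 := mul_lt_mul_of_pos_left hb hps
  have h3 : 1 - p * t < (1 - p * s) * (1 - d) ^ p := by linarith
  have h4 := mul_lt_mul_of_pos_right h3 h0
  linarith

theorem existsUnique_isCriticalExponent {K : ℝ} (hp : 1 < p) (hK : 1 < K) :
    ∃! p₀, IsCriticalExponent p K p₀ := by
  have hK0 : 0 < K := by linarith
  have hp0 : 0 < p := by linarith
  have hp1 : p⁻¹ < 1 := inv_lt_one_of_one_lt₀ hp
  refine existsUnique_of_exists_of_unique ?_ ?_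
  · have hcont : ContinuousOn (criticalRatio p) (Set.Icc 0 p⁻¹) := by
      refine ContinuousOn.div (by fun_prop)
        (ContinuousOn.rpow_const (by fun_prop) fun s hs => Or.inr hp0.le) fun s hs => ?_
      exact (Real.rpow_pos_of_pos (by linarith [hs.2]) p).ne'
    have hmem : K⁻¹ ∈ Set.Ioo (criticalRatio p p⁻¹) (criticalRatio p 0) := by
      have h1 : criticalRatio p p⁻¹ = 0 := by simp [criticalRatio, hp0.ne']
      have h2 : criticalRatio p 0 = 1 := by simp [criticalRatio]
      rw [h1, h2]
      exact ⟨inv_pos.2 hK0, inv_lt_one_of_one_lt₀ hK⟩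
    obtain ⟨s, hs, hsK⟩ := intermediate_value_Ioo' (inv_pos.2 hp0).le hcont hmem
    have hs1 : 1 < s⁻¹ := (one_lt_inv₀ hs.1).2 (hs.2.trans hp1)
    refine ⟨s⁻¹, (lt_inv_comm₀ hs.1 hp0).1 hs.2, ?_⟩
    rw [← criticalRatio_inv hs1, inv_inv, hsK, inv_mul_cancel₀ hK0.ne']
  · have key : ∀ x y, IsCriticalExponent p K x → IsCriticalExponent p K y → ¬ x < y := by
      intro x y hx hy hxy
      have hlt := criticalRatio_lt (s := y⁻¹) (t := x⁻¹) hp (inv_nonneg.2 (by linarith [hy.1]))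
        (inv_strictAnti₀ (hp0.trans hx.1) hxy) (inv_strictAnti₀ hp0 hx.1)
      rw [criticalRatio_inv (hp.trans hx.1), criticalRatio_inv (hp.trans hy.1)] at hlt
      have := mul_lt_mul_of_pos_right hlt hK0
      rw [hx.2, hy.2] at this
      exact lt_irrefl _ this
    intro x y hx hy
    exact le_antisymm (not_lt.1 (key y x hy hx)) (not_lt.1 (key x y hx hy))

end CriticalExponent

/-! ### Conclusion -/

/-- A reverse Hölder inequality on a homogeneous tree gives integrability to every power below an
exponent `r` that satisfies `((r - p) / r) (r / (r - 1)) ^ p (k c - k + 1) ≤ 1`. -/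
theorem memLp_of_reverseHolderOn {X : Type*} [MeasurableSpace X] {μ : Measure X}
    [IsProbabilityMeasure μ] {k : ℕ} (hk : k ≠ 0) {T : Set (Set X)} (hT : IsHomogeneousTree μ k T)
    (hgen : GeneratesModNull μ T) {p c : ℝ} (hp : 1 < p) (hc : 1 ≤ c) {φ : X → ℝ}
    (hφ0 : ∀ x, 0 ≤ φ x) (hφ : Integrable φ μ) (hRH : ReverseHolderOn μ T p c φ) {q r : ℝ}
    (hpq : p < q) (hqr : q < r)
    (hr : (r - p) / r * (r / (r - 1)) ^ p * ((k : ℝ) * c - k + 1) ≤ 1) :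
    MemLp φ (ENNReal.ofReal q) μ := by
  have hr1 : 0 < r - 1 := by linarith
  have hr0 : 0 < r := by linarith
  have hrp : 0 < r - p := by linarith
  -- When `r` solves the critical equation, `β = r/(r - 1)` is the minimiser of `(K β^p - 1)/(β -
  -- 1)` over `β > 1`.
  have hβ : 1 < r / (r - 1) := by rw [one_lt_div hr1]; linarith
  have hK : 1 ≤ (k : ℝ) * c - k + 1 := by nlinarith [(k.cast_nonneg : (0 : ℝ) ≤ k)]
  have hβp : 1 ≤ (r / (r - 1)) ^ p := Real.one_le_rpow hβ.le (by linarith)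
  have hβ1 : r / (r - 1) - 1 = (r - 1)⁻¹ := by field_simp; ring
  have hint0 : 0 ≤ ∫ x, φ x ∂μ := integral_nonneg hφ0
  have hMr : (((k : ℝ) * c - k + 1) * (r / (r - 1)) ^ p - 1) / (r / (r - 1) - 1) * (r - p) ≤
      p * (r - 1) := by
    rw [hβ1, div_inv_eq_mul]
    have h1 : (r - p) * ((((k : ℝ) * c - k + 1)) * (r / (r - 1)) ^ p) ≤ r := by
      have := mul_le_mul_of_nonneg_left hr hr0.le
      rw [mul_one] at this
      refine le_trans (le_of_eq ?_) this
      field_simp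
    nlinarith
  set M := (((k : ℝ) * c - k + 1) * (r / (r - 1)) ^ p - 1) / (r / (r - 1) - 1) with hM
  have hM0 : 0 ≤ M := div_nonneg (by nlinarith) (by linarith)
  have hMq : M * (q - p) < p * (q - 1) := by
    have h1 : M * (r - p) * (q - p) ≤ p * (r - 1) * (q - p) :=
      mul_le_mul_of_nonneg_right hMr (by linarith)
    -- The two sides differ by `p (p - 1)(r - q)`.
    have h2 : p * (r - 1) * (q - p) < p * (q - 1) * (r - p) := by
      nlinarith [mul_pos (mul_pos (by linarith : 0 < p) (sub_pos.2 hp)) (sub_pos.2 hqr)]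
    by_contra! hcon
    have := mul_le_mul_of_nonneg_right hcon hrp.le
    linarith
  obtain ⟨C, h⟩ := id hT
  -- The added `1` keeps the starting level positive even when `φ` vanishes a.e.
  exact memLp_of_integral_max_rpow_sub_le (τ₀ := 1 + ∫ x, φ x ∂μ) hp hpq hM0 hMq hφ0 hφ
    (integrable_rpow_of_reverseHolderOn hp hφ0 hφ h.univ_mem hRH) (by linarith) fun τ hτ =>
    integral_max_rpow_sub_le hk hT hgen hp hc hφ0 hφ hRH (by linarith) hβ (by linarith)

theorem corollary3p1 {X : Type*} [MeasurableSpace X] (μ : Measure X) [IsProbabilityMeasure μ]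
    (hμ : IsNonatomic μ) (k : ℕ) (hk : 1 < k) (T : Set (Set X)) (hT : IsHomogeneousTree μ k T)
    (hgen : GeneratesModNull μ T) (p c : ℝ) (hp : 1 < p) (hc : 1 ≤ c)
    (φ : X → ℝ) (hφ0 : ∀ x, 0 ≤ φ x) (hφ : Integrable φ μ) (hRH : ReverseHolderOn μ T p c φ) :
    (1 < c → ∃! p₀ : ℝ, IsCriticalExponent p ((k : ℝ) * c - k + 1) p₀) ∧
    (∀ p₀ : ℝ, IsCriticalExponent p ((k : ℝ) * c - k + 1) p₀ →
      ∀ q : ℝ, p ≤ q → q < p₀ → MemLp φ (ENNReal.ofReal q) μ) ∧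
    (c = 1 → ∀ q : ℝ, p ≤ q → MemLp φ (ENNReal.ofReal q) μ) := by
  have hk0 : k ≠ 0 := by omega
  have hk1 : (1 : ℝ) < k := by exact_mod_cast hk
  refine ⟨fun hc1 => existsUnique_isCriticalExponent hp (by nlinarith), ?_, ?_⟩
  · intro p₀ hp₀ q hpq hq
    -- An intermediate exponent covers the endpoint `q = p`, where the strict `p < q` is missing.
    obtain ⟨q', hq', hq'p⟩ := exists_between hq
    exact (memLp_of_reverseHolderOn hk0 hT hgen hp hc hφ0 hφ hRH (hpq.trans_lt hq') hq'p
      hp₀.2.le).mono_exponent (ENNReal.ofReal_le_ofReal hq'.le)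
  · rintro rfl q hpq
    have hq : q < q + 1 := by linarith
    have hr : 1 < q + 2 := by linarith
    refine (memLp_of_reverseHolderOn (q := q + 1) (r := q + 2) hk0 hT hgen hp hc hφ0 hφ hRH
      (by linarith) (by linarith) ?_).mono_exponent (ENNReal.ofReal_le_ofReal hq.le)
    have := criticalRatio_lt (s := 0) (t := (q + 2)⁻¹) hp le_rfl (by positivity)
      (inv_strictAnti₀ (by linarith) (by linarith))
    rw [criticalRatio_inv hr] at this
    have h1 : criticalRatio p 0 = 1 := by simp [criticalRatio]
    rw [h1] at this
    simpa using this.le
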